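/- Let $n\ge 1$, let $\mathcal E$ be a complex Hilbert space, and for a Hilbert space $\mathcal F$ let $H^2_{\mathcal F}(\mathbb D^n)$ be the $\mathcal F$-valued Hardy space of the polydisc (the reproducing kernel Hilbert space with kernel $\prod_{i}(1-z_i\bar w_i)^{-1}I_{\mathcal F}$). Put $\mathcal E_n=H^2_{\mathcal E}(\mathbb D^n)=H^2(\mathbb D^n)\otimes\mathcal E$, let $\kappa_i(w)=M_{z_i}\in\mathcal B(\mathcal E_n)$ ($w\in\mathbb D$, $i=1,\dots,n$) be the constant function whose value is multiplication by $z_i$ on $\mathcal E_n$, and let $M_z$, $M_{\kappa_1},\dots,M_{\kappa_n}$ be the operators of multiplication by $z$ and by the $\kappa_i$ on $H^2_{\mathcal E_n}(\mathbb D)$. For Hilbert spaces $\mathcal W,\mathcal F$, a bounded analytic function $\Theta:\mathbb D\to\mathcal B(\mathcal W,\mathcal F)$ is called inner if $M_\Theta f=\Theta f$ defines an isometry $H^2_{\mathcal W}(\mathbb D)\to H^2_{\mathcal F}(\mathbb D)$. Let $\mathcal S_1,\mathcal S_2$ be closed subspaces of $H^2_{\mathcal E_n}(\mathbb D)$ that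 are invariant for $(M_z,M_{\kappa_1},\dots,M_{\kappa_n})$. For $j=1,2$ let $\mathcal W_j=\mathcal S_j\ominus z\mathcal S_j$ and $$\Phi_{j,i}(w)=P_{\mathcal W_j}(I_{\mathcal S_j}-wP_{\mathcal S_j}M_z^*)^{-1}M_{\kappa_i}|_{\mathcal W_j}\in\mathcal B(\mathcal W_j)\qquad(w\in\mathbb D,\ i=1,\dots,n),$$ and let $\Theta_j:\mathbb D\to\mathcal B(\mathcal W_j,\mathcal E_n)$ be an inner function with $$\mathcal S_j=\Theta_jH^2_{\mathcal W_j}(\mathbb D)\quad\text{and}\quad\kappa_i\Theta_j=\Theta_j\Phi_{j,i}\quad(i=1,\dots,n).$$ Then $\mathcal S_1\subseteq\mathcal S_2$ if and only if there exists an inner function $\Psi:\mathbb D\to\mathcal B(\mathcal W_1,\mathcal W_2)$ such that $\Theta_1=\Theta_2\Psi$ and $\Psi\Phi_{1,i}=\Phi_{2,i}\Psi$ for all $i=1,\dots,n$. -/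

import Mathlib

open scoped ComplexConjugate InnerProductSpace ENNReal
open Complex (UnitDisc)

noncomputable section

/-! ### Monomials on the polydisc -/

theorem hasSum_monomial {n : ℕ} (x : Fin n → ℂ) (hx : ∀ i, ‖x i‖ < 1) :
    HasSum (fun k : Fin n → ℕ => ∏ i, x i ^ k i) (∏ i, (1 - x i)⁻¹) ∧
      Summable (fun k : Fin n → ℕ => ‖∏ i, x i ^ k i‖) := by
  induction n with
  | zero =>
    refine ⟨?_, (hasSum_fintype _).summable⟩
    simp
  | succ n ih =>
    obtain ⟨h1, h2⟩ := ih (fun i => x i.succ) (fun i => hx _)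
    have g1 : HasSum (fun m : ℕ => x 0 ^ m) (1 - x 0)⁻¹ := hasSum_geometric_of_norm_lt_one (hx 0)
    have g2 : Summable (fun m : ℕ => ‖x 0 ^ m‖) := by
      simpa using summable_geometric_of_lt_one (norm_nonneg _) (hx 0)
    have hs := Summable.mul_norm g2 h2
    have hm : Summable fun p : ℕ × (Fin n → ℕ) => x 0 ^ p.1 * ∏ i, x i.succ ^ p.2 i :=
      hs.of_norm
    have aux : ∀ (f : ℕ → ℂ) (g : (Fin n → ℕ) → ℂ) (s t : ℂ), HasSum f s → HasSum g t →
        Summable (fun p : ℕ × (Fin n → ℕ) => f p.1 * g p.2) →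
        HasSum (fun p : ℕ × (Fin n → ℕ) => f p.1 * g p.2) (s * t) := by
      intro f g s t hf hg hfg
      exact HasSum.mul hf hg hfg
    have hp : HasSum (fun p : ℕ × (Fin n → ℕ) => x 0 ^ p.1 * ∏ i, x i.succ ^ p.2 i)
        ((1 - x 0)⁻¹ * ∏ i : Fin n, (1 - x i.succ)⁻¹) := 
      aux (fun m => x 0 ^ m) (fun k => ∏ i, x i.succ ^ k i) _ _ g1 h1 hm
    have e1 : (fun k : Fin (n + 1) → ℕ => ∏ i, x i ^ k i) ∘ (Fin.consEquiv (fun _ => ℕ)) =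
        fun p : ℕ × (Fin n → ℕ) => x 0 ^ p.1 * ∏ i, x i.succ ^ p.2 i := by
      funext p
      simp [Fin.prod_univ_succ, Fin.consEquiv]
    constructor
    · rw [← (Fin.consEquiv (fun _ => ℕ)).hasSum_iff, e1, Fin.prod_univ_succ]
      exact hp
    · rw [← (Fin.consEquiv (fun _ => ℕ)).summable_iff]
      refine hs.congr fun p => ?_
      exact (congrArg norm (congrFun e1 p)).symm

/-- The square-summable family of all monomials `z ^ k` at a point `z` of the polydisc. -/
def monomialSeq {n : ℕ} (z : Fin n → UnitDisc) : lp (fun _ : Fin n → ℕ => ℂ) 2 :=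
  ⟨fun k => ∏ i, (z i : ℂ) ^ k i, by
    refine memℓp_gen ?_
    have h := (hasSum_monomial (fun i => (z i : ℂ) ^ 2) (fun i => by
      rw [norm_pow]; exact pow_lt_one₀ (norm_nonneg _) (z i).norm_lt_one two_ne_zero)).2
    refine h.congr fun k => ?_
    simp [norm_prod, ← Finset.prod_pow, ← pow_mul, mul_comm]⟩

theorem monomialSeq_apply {n : ℕ} (z : Fin n → UnitDisc) (k : Fin n → ℕ) :
    monomialSeq z k = ∏ i, (z i : ℂ) ^ k i := rfl

theorem powerSeries_coeff_eq_zero {E : Type*} [NormedAddCommGroup E] [NormedSpace ℂ E]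
    [CompleteSpace E] (b : ℕ → E) (hs : ∀ w : UnitDisc, Summable fun m => ‖(w : ℂ) ^ m • b m‖)
    (h0 : ∀ w : UnitDisc, ∑' m, (w : ℂ) ^ m • b m = 0) : b = 0 := by
  let p : FormalMultilinearSeries ℂ ℂ E := fun m => ContinuousMultilinearMap.mkPiRing ℂ (Fin m) (b m)
  have hb : ∀ m, ‖p m‖ = ‖b m‖ := fun m => by simp [p]
  have hr : ((1 / 2 : NNReal) : ℝ≥0∞) ≤ p.radius := by
    refine p.le_radius_of_summable_norm ?_
    have := hs (UnitDisc.mk (1 / 2) (by norm_num))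
    refine this.congr fun m => ?_
    rw [hb, norm_smul, mul_comm]
    simp
  have hp : HasFPowerSeriesOnBall (fun _ : ℂ => (0 : E)) p 0 ((1 / 2 : NNReal) : ℝ≥0∞) := by
    refine ⟨hr, by simp, fun {y} hy => ?_⟩
    have hy' : ‖y‖ < 1 := by
      have : ‖y‖ < 1 / 2 := by
        have := hy
        rw [Metric.eball_coe] at this
        simpa using this
      linarith
    have hw := h0 (UnitDisc.mk y hy')
    have hw2 := (hs (UnitDisc.mk y hy')).of_norm.hasSum
    rw [hw] at hw2
    simpa [p] using hw2
  have hz : p = 0 := hp.hasFPowerSeriesAt.eq_zero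
  funext m
  have := hb m
  rw [hz] at this
  simpa using this.symm

/-- A power series on the polydisc that vanishes identically has zero coefficients. -/
theorem coeff_eq_zero_of_tsum_eq_zero {E : Type*} [NormedAddCommGroup E] [NormedSpace ℂ E]
    [CompleteSpace E] {n : ℕ} (a : (Fin n → ℕ) → E)
    (hs : ∀ z : Fin n → UnitDisc, Summable fun k => ‖(∏ i, (z i : ℂ) ^ k i) • a k‖)
    (h0 : ∀ z : Fin n → UnitDisc, ∑' k, (∏ i, (z i : ℂ) ^ k i) • a k = 0) : a = 0 := by
  induction n with
  | zero =>
    funext k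
    have h := h0 Fin.elim0
    rw [tsum_fintype, Fintype.sum_eq_single k fun j hj => absurd (Subsingleton.elim j k) hj] at h
    simpa using h
  | succ n ih =>
    have e1 : ∀ (w : UnitDisc) (z : Fin n → UnitDisc) (p : ℕ × (Fin n → ℕ)),
        (∏ i, ((Fin.cons w z : Fin (n + 1) → UnitDisc) i : ℂ) ^
          (Fin.cons p.1 p.2 : Fin (n + 1) → ℕ) i) • a (Fin.cons p.1 p.2) =
        (w : ℂ) ^ p.1 • ((∏ i, (z i : ℂ) ^ p.2 i) • a (Fin.cons p.1 p.2)) := by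
      intro w z p
      simp [Fin.prod_univ_succ, mul_smul]
    have hs' : ∀ (w : UnitDisc) (z : Fin n → UnitDisc), Summable fun p : ℕ × (Fin n → ℕ) =>
        ‖(w : ℂ) ^ p.1 • ((∏ i, (z i : ℂ) ^ p.2 i) • a (Fin.cons p.1 p.2))‖ := by
      intro w z
      have := (Fin.consEquiv (fun _ => ℕ)).summable_iff.2 (hs (Fin.cons w z))
      exact this.congr fun p => by rw [← e1]; rfl
    have h0' : ∀ (w : UnitDisc) (z : Fin n → UnitDisc), ∑' p : ℕ × (Fin n → ℕ),
        (w : ℂ) ^ p.1 • ((∏ i, (z i : ℂ) ^ p.2 i) • a (Fin.cons p.1 p.2)) = 0 := by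
      intro w z
      rw [← h0 (Fin.cons w z), ← (Fin.consEquiv (fun _ => ℕ)).tsum_eq]
      exact tsum_congr fun p => by rw [← e1]; rfl
    have key : ∀ m : ℕ, ∀ z : Fin n → UnitDisc,
        (Summable fun k : Fin n → ℕ => ‖(∏ i, (z i : ℂ) ^ k i) • a (Fin.cons m k)‖) := by
      intro m z
      have hh := (hs' (UnitDisc.mk (1 / 2) (by norm_num)) z).prod_factor m
      simp only [norm_smul _ ((∏ i, (z i : ℂ) ^ _) • a (Fin.cons m _))] at hh
      refine (summable_mul_left_iff ?_).1 hh
      simp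
    have key2 : ∀ z : Fin n → UnitDisc,
        (fun m : ℕ => ∑' k : Fin n → ℕ, (∏ i, (z i : ℂ) ^ k i) • a (Fin.cons m k)) = 0 := by
      intro z
      have hc : ∀ (w : UnitDisc) (m : ℕ), ∑' k : Fin n → ℕ,
          (w : ℂ) ^ m • ((∏ i, (z i : ℂ) ^ k i) • a (Fin.cons m k)) =
          (w : ℂ) ^ m • ∑' k : Fin n → ℕ, (∏ i, (z i : ℂ) ^ k i) • a (Fin.cons m k) :=
        fun w m => (key m z).of_norm.tsum_const_smul _
      refine powerSeries_coeff_eq_zero _ (fun w => ?_) (fun w => ?_)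
      · have h1 := (hs' w z).prod
        refine Summable.of_nonneg_of_le (fun _ => norm_nonneg _) (fun m => ?_) h1
        rw [← hc]
        exact norm_tsum_le_tsum_norm ((hs' w z).prod_factor m)
      · rw [← h0' w z, (hs' w z).of_norm.tsum_prod]
        exact tsum_congr fun m => (hc w m).symm
    funext k
    have h := ih (fun j => a (Fin.cons (k 0) j)) (key (k 0)) (fun z => congrFun (key2 z) (k 0))
    have h' := congrFun h (Fin.tail k)
    simpa [Fin.cons_self_tail] using h'

/-! ### The vector-valued Hardy space of the polydisc -/

/-- The Hardy space `H²_E(𝔻ⁿ)` of all functions `f(z) = ∑ₖ zᵏ aₖ` on the polydisc with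
coefficients `aₖ ∈ E`, `∑ₖ ‖aₖ‖² < ∞`, normed by `‖f‖² = ∑ₖ ‖aₖ‖²`. An element is stored as its
family of coefficients; `Hardy.instRKHS` makes it a function on the polydisc, and
`Hardy.kernel_eq` shows that this is the reproducing kernel Hilbert space of the Szegő kernel. -/
def Hardy (n : ℕ) (E : Type*) [NormedAddCommGroup E] : Type _ :=
  lp (fun _ : Fin n → ℕ => E) 2

namespace Hardy

section Basic

variable {n : ℕ} {E : Type*} [NormedAddCommGroup E]

instance : NormedAddCommGroup (Hardy n E) :=
  inferInstanceAs (NormedAddCommGroup (lp (fun _ : Fin n → ℕ => E) 2))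

instance [InnerProductSpace ℂ E] : InnerProductSpace ℂ (Hardy n E) :=
  inferInstanceAs (InnerProductSpace ℂ (lp (fun _ : Fin n → ℕ => E) 2))

instance [CompleteSpace E] : CompleteSpace (Hardy n E) :=
  inferInstanceAs (CompleteSpace (lp (fun _ : Fin n → ℕ => E) 2))

/-- The underlying square-summable family. -/
def toLp (f : Hardy n E) : lp (fun _ : Fin n → ℕ => E) 2 := f

/-- The power series coefficients of `f`. -/
def coeff (f : Hardy n E) (k : Fin n → ℕ) : E := toLp f k

theorem ext_coeff {f g : Hardy n E} (h : ∀ k, f.coeff k = g.coeff k) : f = g :=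
  lp.ext (funext h)

/-- The element with the given square-summable coefficients. -/
def ofCoeff (a : (Fin n → ℕ) → E) (ha : Summable fun k => ‖a k‖ ^ 2) : Hardy n E :=
  ⟨a, memℓp_gen (by simpa using ha)⟩

@[simp]
theorem coeff_ofCoeff (a : (Fin n → ℕ) → E) (ha : Summable fun k => ‖a k‖ ^ 2)
    (k : Fin n → ℕ) : (ofCoeff a ha).coeff k = a k := rfl

@[simp]
theorem coeff_add (f g : Hardy n E) (k : Fin n → ℕ) :
    (f + g).coeff k = f.coeff k + g.coeff k := rfl

@[simp]
theorem coeff_smul [InnerProductSpace ℂ E] (c : ℂ) (f : Hardy n E) (k : Fin n → ℕ) :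
    (c • f).coeff k = c • f.coeff k := rfl

theorem hasSum_norm_sq (f : Hardy n E) : HasSum (fun k => ‖f.coeff k‖ ^ 2) (‖f‖ ^ 2) := by
  have := lp.hasSum_norm (p := 2) (by simp) (toLp f)
  simp only [ENNReal.toReal_ofNat, Real.rpow_ofNat] at this
  exact this

theorem inner_eq_tsum [InnerProductSpace ℂ E] (f g : Hardy n E) :
    ⟪f, g⟫_ℂ = ∑' k, ⟪f.coeff k, g.coeff k⟫_ℂ := rfl

end Basic

section Eval

variable {n : ℕ} {E : Type*} [NormedAddCommGroup E] [InnerProductSpace ℂ E]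

theorem summable_eval (f : Hardy n E) (z : Fin n → UnitDisc) :
    Summable (fun k => ‖(∏ i, (z i : ℂ) ^ k i) • f.coeff k‖) ∧
      ∑' k, ‖(∏ i, (z i : ℂ) ^ k i) • f.coeff k‖ ≤ ‖monomialSeq z‖ * ‖f‖ := by
  have h := lp.tsum_mul_le_mul_norm (p := 2) (q := 2)
    (by rw [Real.holderConjugate_iff]; norm_num) (lp.toNorm (monomialSeq z))
    (lp.toNorm (toLp f))
  rw [lp.norm_toNorm, lp.norm_toNorm] at h
  simp only [norm_smul]
  simp only [lp.toNorm, norm_norm] at h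
  exact h

/-- Evaluation at a point `z` of the polydisc, `f ↦ ∑ₖ zᵏ aₖ`. -/
def evalCLM [CompleteSpace E] (z : Fin n → UnitDisc) : Hardy n E →L[ℂ] E :=
  LinearMap.mkContinuous
    { toFun := fun f => ∑' k, (∏ i, (z i : ℂ) ^ k i) • f.coeff k
      map_add' := fun f g => by
        simp only [coeff_add, smul_add]
        exact (summable_eval f z).1.of_norm.tsum_add (summable_eval g z).1.of_norm
      map_smul' := fun c f => by
        simp only [coeff_smul, RingHom.id_apply, smul_comm _ c]
        exact (summable_eval f z).1.of_norm.tsum_const_smul c }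
    ‖monomialSeq z‖
    (fun f => (norm_tsum_le_tsum_norm (summable_eval f z).1).trans (summable_eval f z).2)

/-- The elements of the Hardy space are functions `f(z) = ∑ₖ zᵏ aₖ` on the polydisc. -/
instance instRKHS [CompleteSpace E] : RKHS ℂ (Hardy n E) (Fin n → UnitDisc) E where
  coeCLM := ContinuousLinearMap.pi evalCLM
  coeCLM_injective := by
    refine (injective_iff_map_eq_zero _).2 fun f hf => ext_coeff fun k => ?_
    exact congrFun (coeff_eq_zero_of_tsum_eq_zero f.coeff (fun z => (summable_eval f z).1)
      (fun z => congrFun hf z)) k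

variable [CompleteSpace E]

theorem apply_eq_tsum (f : Hardy n E) (z : Fin n → UnitDisc) :
    f z = ∑' k, (∏ i, (z i : ℂ) ^ k i) • f.coeff k := rfl

theorem hasSum_apply (f : Hardy n E) (z : Fin n → UnitDisc) :
    HasSum (fun k => (∏ i, (z i : ℂ) ^ k i) • f.coeff k) (f z) :=
  (summable_eval f z).1.of_norm.hasSum

/-- The reproducing kernel is the Szegő kernel `∏ᵢ (1 - zᵢ w̄ᵢ)⁻¹ I_E`. -/
theorem kernel_eq (z w : Fin n → UnitDisc) :
    RKHS.kernel (Hardy n E) z w =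
      (∏ i, (1 - (z i : ℂ) * conj (w i : ℂ))⁻¹) • ContinuousLinearMap.id ℂ E := by
  ext v
  have hsum : Summable fun k : Fin n → ℕ => ‖(conj (∏ i, (w i : ℂ) ^ k i)) • v‖ ^ 2 := by
    have h := (lp.memℓp (monomialSeq w)).summable (by simp)
    simp only [ENNReal.toReal_ofNat, Real.rpow_ofNat, monomialSeq_apply] at h
    refine (h.mul_right (‖v‖ ^ 2)).congr fun k => ?_
    rw [norm_smul, RCLike.norm_conj, mul_pow]
  have hk : RKHS.kerFun (Hardy n E) w v = ofCoeff _ hsum := by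
    refine ext_inner_right ℂ fun f => ?_
    rw [RKHS.kerFun_inner, inner_eq_tsum, apply_eq_tsum, ← innerSL_apply_apply ℂ,
      ContinuousLinearMap.map_tsum _ (summable_eval f w).1.of_norm]
    refine tsum_congr fun k => ?_
    simp [mul_comm]
  rw [← RKHS.kerFun_apply, hk, apply_eq_tsum]
  simp only [coeff_ofCoeff, smul_smul]
  have hx : ∀ i, ‖(z i : ℂ) * conj (w i : ℂ)‖ < 1 := fun i => by
    rw [norm_mul, RCLike.norm_conj]
    exact mul_lt_one_of_nonneg_of_lt_one_left (norm_nonneg _) (z i).norm_lt_one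
      (w i).norm_lt_one.le
  have hs := (hasSum_monomial _ hx).1
  have := (hs.smul_const v).tsum_eq
  simpa [mul_pow, Finset.prod_mul_distrib, map_prod] using this

end Eval

end Hardy

/-! ### Multiplication operators -/

namespace Hardy

section Mul

variable {n : ℕ} {E F : Type*}
  [NormedAddCommGroup E] [InnerProductSpace ℂ E] [CompleteSpace E]
  [NormedAddCommGroup F] [InnerProductSpace ℂ F] [CompleteSpace F]

theorem add_single_injective (i : Fin n) :
    Function.Injective fun k : Fin n → ℕ => k + Pi.single i 1 :=
  add_left_injective _

theorem hasSum_norm_sq_shift {n : ℕ} {E : Type*} [NormedAddCommGroup E] (i : Fin n) (f : Hardy n E) :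
    HasSum (fun k => ‖Function.extend (fun k : Fin n → ℕ => k + Pi.single i 1) f.coeff 0 k‖ ^ 2)
      (‖f‖ ^ 2) := by
  rw [← (add_single_injective i).hasSum_iff]
  · simpa [Function.comp_def, (add_single_injective i).extend_apply] using hasSum_norm_sq f
  · intro k hk
    rw [Function.extend_apply' _ _ _ (by simpa using hk)]
    simp

/-- The operator of multiplication by the `i`-th coordinate function on `H²_E(𝔻ⁿ)`, as a linear
isometry: it shifts the coefficients. -/
def mulCoordIsometry (i : Fin n) : Hardy n E →ₗᵢ[ℂ] Hardy n E where
  toFun := fun f =>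
    ofCoeff (Function.extend (fun k : Fin n → ℕ => k + Pi.single i 1) f.coeff 0)
      (hasSum_norm_sq_shift i f).summable
  map_add' := fun f g => ext_coeff fun k => by
    by_cases hk : ∃ j : Fin n → ℕ, j + Pi.single i 1 = k
    · obtain ⟨j, rfl⟩ := hk
      simp [(add_single_injective i).extend_apply]
    · simp [Function.extend_apply' _ _ _ hk]
  map_smul' := fun c f => ext_coeff fun k => by
    by_cases hk : ∃ j : Fin n → ℕ, j + Pi.single i 1 = k
    · obtain ⟨j, rfl⟩ := hk
      simp [(add_single_injective i).extend_apply]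
    · simp [Function.extend_apply' _ _ _ hk]
  norm_map' := fun f => by
    refine (sq_eq_sq₀ (norm_nonneg _) (norm_nonneg _)).1 ?_
    exact (hasSum_norm_sq _).unique (hasSum_norm_sq_shift i f)

/-- The operator `M_{z_i}` of multiplication by the `i`-th coordinate function on `H²_E(𝔻ⁿ)`;
`mulCoord_apply` says that `(M_{z_i} f)(z) = z_i f(z)`. -/
def mulCoord (i : Fin n) : Hardy n E →L[ℂ] Hardy n E :=
  (mulCoordIsometry i).toContinuousLinearMap

theorem norm_mulCoord (i : Fin n) (f : Hardy n E) : ‖mulCoord i f‖ = ‖f‖ :=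
  (mulCoordIsometry i).norm_map f

theorem coeff_mulCoord (i : Fin n) (f : Hardy n E) (k : Fin n → ℕ) :
    (mulCoord i f).coeff k =
      Function.extend (fun k : Fin n → ℕ => k + Pi.single i 1) f.coeff 0 k := rfl

theorem mulCoord_apply (i : Fin n) (f : Hardy n E) (z : Fin n → UnitDisc) :
    mulCoord i f z = (z i : ℂ) • f z := by
  refine (hasSum_apply _ z).unique ?_
  rw [← (add_single_injective i).hasSum_iff]
  · have h := (hasSum_apply f z).const_smul (z i : ℂ)
    have e : ∀ k : Fin n → ℕ, ∏ j, (z j : ℂ) ^ (k + Pi.single i 1 : Fin n → ℕ) j =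
        (z i : ℂ) * ∏ j, (z j : ℂ) ^ k j := by
      intro k
      have : ∏ j, (z j : ℂ) ^ (Pi.single i 1 : Fin n → ℕ) j = z i := by
        rw [Finset.prod_eq_single i]
        · simp
        · intro j _ hj
          simp [Pi.single_eq_of_ne hj]
        · simp
      simp only [Pi.add_apply, pow_add, Finset.prod_mul_distrib, this, mul_comm]
    simpa only [Function.comp_def, coeff_mulCoord, (add_single_injective i).extend_apply, e,
      mul_smul] using h
  · intro k hk
    rw [coeff_mulCoord, Function.extend_apply' _ _ _ (by simpa using hk)]
    simp

theorem summable_norm_sq_map (K : E →L[ℂ] F) (f : Hardy n E) :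
    Summable fun k => ‖K (f.coeff k)‖ ^ 2 := by
  refine Summable.of_nonneg_of_le (fun _ => by positivity) (fun k => ?_)
    ((hasSum_norm_sq f).summable.mul_left (‖K‖ ^ 2))
  rw [← mul_pow]
  gcongr
  exact K.le_opNorm _

/-- Multiplication by the constant operator-valued function with value `K`; `mulConst_apply` says
that `(M_K f)(z) = K (f(z))`. -/
def mulConst (K : E →L[ℂ] F) : Hardy n E →L[ℂ] Hardy n F :=
  LinearMap.mkContinuous
    { toFun := fun f => ofCoeff (fun k => K (f.coeff k)) (summable_norm_sq_map K f)
      map_add' := fun f g => ext_coeff fun k => by simp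
      map_smul' := fun c f => ext_coeff fun k => by simp }
    ‖K‖
    (fun f => by
      refine (sq_le_sq₀ (norm_nonneg _) (by positivity)).1 ?_
      rw [mul_pow]
      refine hasSum_le (fun k => ?_) (hasSum_norm_sq _) ((hasSum_norm_sq f).mul_left (‖K‖ ^ 2))
      rw [← mul_pow]
      gcongr
      exact K.le_opNorm _)

theorem coeff_mulConst (K : E →L[ℂ] F) (f : Hardy n E) (k : Fin n → ℕ) :
    (mulConst K f).coeff k = K (f.coeff k) := rfl

theorem mulConst_apply (K : E →L[ℂ] F) (f : Hardy n E) (z : Fin n → UnitDisc) :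
    mulConst K f z = K (f z) := by
  refine (hasSum_apply _ z).unique ?_
  simpa [coeff_mulConst] using K.hasSum (hasSum_apply f z)

end Mul

end Hardy

/-! ### Bounded analytic and inner operator-valued functions on the disc -/

/-- A point of the disc as a point of the one-dimensional polydisc. -/
abbrev discPt (w : UnitDisc) : Fin 1 → UnitDisc := fun _ => w

section Inner

variable {W F : Type*}
  [NormedAddCommGroup W] [InnerProductSpace ℂ W] [CompleteSpace W]
  [NormedAddCommGroup F] [InnerProductSpace ℂ F] [CompleteSpace F]

/-- `Θ ∈ H^∞_{B(W,F)}(𝔻)`: `Θ` is bounded and analytic on the open unit disc. Values outside the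
disc are irrelevant. -/
def IsBoundedAnalytic (Θ : ℂ → W →L[ℂ] F) : Prop :=
  DifferentiableOn ℂ Θ (Metric.ball 0 1) ∧ ∃ C : ℝ, ∀ w : UnitDisc, ‖Θ w‖ ≤ C

/-- `g = Θ f`, that is, `g(w) = Θ(w) f(w)` for all `w` in the disc. -/
def IsMul (Θ : ℂ → W →L[ℂ] F) (f : Hardy 1 W) (g : Hardy 1 F) : Prop :=
  ∀ w : UnitDisc, g (discPt w) = Θ w (f (discPt w))

/-- `Θ` is an inner multiplier: it is bounded analytic and the multiplication operator
`M_Θ : H²_W(𝔻) → H²_F(𝔻)`, `M_Θ f = Θ f`, is an isometry. -/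
def IsInner (Θ : ℂ → W →L[ℂ] F) : Prop :=
  IsBoundedAnalytic Θ ∧ ∃ M : Hardy 1 W →ₗᵢ[ℂ] Hardy 1 F, ∀ f, IsMul Θ f (M f)

/-- The set `Θ H²_W(𝔻)` of all products `Θ f` with `f ∈ H²_W(𝔻)`. -/
def mulRange (Θ : ℂ → W →L[ℂ] F) : Set (Hardy 1 F) :=
  {g | ∃ f : Hardy 1 W, IsMul Θ f g}

end Inner

/-! ### Invariant subspaces -/

theorem isUnit_one_sub_of_opNorm_lt_one {H : Type*} [NormedAddCommGroup H] [NormedSpace ℂ H]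
    [CompleteSpace H] (T : H →L[ℂ] H) (hT : ‖T‖ < 1) : IsUnit (1 - T) :=
  isUnit_one_sub_of_norm_lt_one hT

section Invariant

variable {n : ℕ} {E : Type*} [NormedAddCommGroup E] [InnerProductSpace ℂ E] [CompleteSpace E]

/-- The constant operator-valued function `κ_i(w) = M_{z_i}`, with values in the bounded operators
on `E_n = H²_E(𝔻ⁿ)`. -/
def kappa (n : ℕ) (E : Type*) [NormedAddCommGroup E] [InnerProductSpace ℂ E] [CompleteSpace E]
    (i : Fin n) : ℂ → Hardy n E →L[ℂ] Hardy n E :=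
  fun _ => Hardy.mulCoord i

/-- The multiplication operator `M_z` on `H²_F(𝔻)`. -/
def mulZ (F : Type*) [NormedAddCommGroup F] [InnerProductSpace ℂ F] [CompleteSpace F] :
    Hardy 1 F →L[ℂ] Hardy 1 F :=
  Hardy.mulCoord 0

/-- The multiplication operator `M_{κ_i}` on `H²_{E_n}(𝔻)`. -/
def mulKappa (n : ℕ) (E : Type*) [NormedAddCommGroup E] [InnerProductSpace ℂ E] [CompleteSpace E]
    (i : Fin n) : Hardy 1 (Hardy n E) →L[ℂ] Hardy 1 (Hardy n E) :=
  Hardy.mulConst (Hardy.mulCoord i)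

theorem isMul_mulKappa (i : Fin n) (f : Hardy 1 (Hardy n E)) :
    IsMul (kappa n E i) f (mulKappa n E i f) :=
  fun _ => Hardy.mulConst_apply _ _ _

variable (n E) in
/-- A closed subspace of `H²_{E_n}(𝔻)` that is invariant for `(M_z, M_{κ_1}, …, M_{κ_n})`. -/
structure InvariantSubspace where
  /-- The underlying linear subspace. -/
  space : Submodule ℂ (Hardy 1 (Hardy n E))
  isClosed : IsClosed (space : Set (Hardy 1 (Hardy n E)))
  mulZ_mem : ∀ f ∈ space, mulZ (Hardy n E) f ∈ space
  mulKappa_mem : ∀ i, ∀ f ∈ space, mulKappa n E i f ∈ space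

namespace InvariantSubspace

variable (S : InvariantSubspace n E)

instance : CompleteSpace S.space := S.isClosed.completeSpace_coe

/-- The wandering subspace `W = S ⊖ zS`. -/
def wandering : Submodule ℂ (Hardy 1 (Hardy n E)) :=
  S.space ⊓ (S.space.map (mulZ (Hardy n E)).toLinearMap)ᗮ

theorem wandering_le : S.wandering ≤ S.space := inf_le_left

instance : CompleteSpace S.wandering :=
  (S.isClosed.inter (Submodule.isClosed_orthogonal _)).completeSpace_coe

/-- The operator `P_S M_z^*` on `S`. -/
def backShift : S.space →L[ℂ] S.space :=
  S.space.orthogonalProjectionOnto ∘L (ContinuousLinearMap.adjoint (mulZ (Hardy n E))) ∘L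
    S.space.subtypeL

/-- The operator `M_{κ_i}|_W`, with values in `S`. -/
def kappaRestrict (i : Fin n) : S.wandering →L[ℂ] S.space :=
  (mulKappa n E i ∘L S.wandering.subtypeL).codRestrict S.space
    fun f => S.mulKappa_mem i f (S.wandering_le f.2)

/-- The function `Φ_i(w) = P_W (I_S - w P_S M_z^*)⁻¹ M_{κ_i}|_W`, whose values are bounded
operators on `W`. The operator that is inverted is invertible for `w` in the disc, see
`isUnit_one_sub_smul_backShift`. -/
def phi (i : Fin n) (w : ℂ) : S.wandering →L[ℂ] S.wandering :=
  (S.wandering.orthogonalProjectionOnto ∘L S.space.subtypeL) ∘L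
    Ring.inverse (1 - w • S.backShift) ∘L S.kappaRestrict i

theorem isUnit_one_sub_smul_backShift (w : UnitDisc) :
    IsUnit (1 - (w : ℂ) • S.backShift) := by
  have h1 : ‖mulZ (Hardy n E)‖ ≤ 1 :=
    ContinuousLinearMap.opNorm_le_bound _ zero_le_one fun f => by
      rw [one_mul]; exact (Hardy.norm_mulCoord 0 f).le
  have hb : ‖S.backShift‖ ≤ 1 := by
    refine ContinuousLinearMap.opNorm_le_bound _ zero_le_one fun f => ?_
    refine (S.space.norm_orthogonalProjectionOnto_apply_le _).trans ?_
    have h2 : ‖ContinuousLinearMap.adjoint (mulZ (Hardy n E))‖ ≤ 1 := by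
      rw [LinearIsometryEquiv.norm_map]; exact h1
    exact (ContinuousLinearMap.adjoint (mulZ (Hardy n E))).le_of_opNorm_le h2 (f : _)
  have hw : ‖(w : ℂ) • S.backShift‖ < 1 := by
    exact (ContinuousLinearMap.opNorm_smul_le _ _).trans_lt
      ((mul_le_of_le_one_right (norm_nonneg _) hb).trans_lt w.norm_lt_one)
  exact isUnit_one_sub_of_opNorm_lt_one _ hw

end InvariantSubspace

end Invariant

end

/-!
The inclusion `S₁ ⊆ S₂` is a factorization statement about the isometries `M₁ = M_{Θ₁}` and
`M₂ = M_{Θ₂}`, whose ranges are `S₁` and `S₂`. If `S₁ ⊆ S₂`, then `M₁ = M₂ L` for a unique isometry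
`L : H²_{W₁}(𝔻) → H²_{W₂}(𝔻)` (`LinearIsometry.exists_comp_eq`), and `L` commutes with `M_z` because
`M₁` and `M₂` do. An operator commuting with `M_z` is multiplication by its `symbol`, a bounded
analytic function (`isMul_symbol`, `isBoundedAnalytic_symbol`). So `L = M_Ψ` with `Ψ` inner, and
`Θ₁ = Θ₂ Ψ`. Conversely `Θ₁ = Θ₂ Ψ` gives `Θ₁ f = Θ₂ (Ψ f)`.

For the relation `Ψ Φ_{1,i} = Φ_{2,i} Ψ` one cannot cancel `Θ₂(w)` pointwise, since a value of an
inner function need not be injective. The cancellation is done with `M₂` on `H²_{W₂}(𝔻)`, and for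
this the relevant functions have to lie in the Hardy space. The Wold decomposition of `S_j` shows
that `w ↦ Φ_{j,i}(w) η` does: its coefficients are the wandering components of `M_{κ_i} η`, which
are square summable since their squared norms telescope (`InvariantSubspace.wold`). Consequently
the operator `N_{j,i}` on `H²_{W_j}(𝔻)` with `M_j N_{j,i} = M_{κ_i} M_j` is multiplication by
`Φ_{j,i}` (`InvariantSubspace.exists_phi_multiplier`). Now
`M₂ L N_{1,i} = M_{κ_i} M₁ = M_{κ_i} M₂ L = M₂ N_{2,i} L` yields `L N_{1,i} = N_{2,i} L`, which is
the required relation.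
-/

noncomputable section

/-! ### Monomials and coefficients in the Hardy space -/

namespace Hardy

theorem norm_coeff_le {n : ℕ} {E : Type*} [NormedAddCommGroup E] (f : Hardy n E)
    (k : Fin n → ℕ) : ‖f.coeff k‖ ≤ ‖f‖ :=
  lp.norm_apply_le_norm (p := 2) (by norm_num) (toLp f) k

section Monomial

variable {n : ℕ} {E : Type*} [NormedAddCommGroup E] [InnerProductSpace ℂ E]

/-- The function `z ↦ zᵏ a` in the Hardy space, as an operator in the coefficient `a`. -/
def monomial (k : Fin n → ℕ) : E →L[ℂ] Hardy n E :=
  lp.singleContinuousLinearMap ℂ (fun _ : Fin n → ℕ => E) 2 k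

/-- The `k`-th coefficient as a bounded operator on the Hardy space. -/
def coeffCLM (k : Fin n → ℕ) : Hardy n E →L[ℂ] E :=
  lp.evalCLM ℂ (fun _ : Fin n → ℕ => E) 2 k

theorem coeff_monomial (k j : Fin n → ℕ) (a : E) :
    (monomial k a).coeff j = (Pi.single k a : (Fin n → ℕ) → E) j := rfl

theorem norm_monomial (k : Fin n → ℕ) (a : E) : ‖monomial k a‖ = ‖a‖ :=
  lp.norm_single (p := 2) (E := fun _ : Fin n → ℕ => E) (by norm_num) k a

theorem hasSum_monomial_coeff (f : Hardy n E) : HasSum (fun k => monomial k (f.coeff k)) f :=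
  lp.hasSum_single (p := 2) (by norm_num) (toLp f)

theorem monomial_apply [CompleteSpace E] (k : Fin n → ℕ) (a : E) (z : Fin n → UnitDisc) :
    monomial k a z = (∏ i, (z i : ℂ) ^ k i) • a := by
  rw [apply_eq_tsum, tsum_eq_single k]
  · simp [coeff_monomial]
  · intro j hj
    simp [coeff_monomial, Pi.single_eq_of_ne hj]

theorem monomial_zero_apply [CompleteSpace E] (a : E) (z : Fin n → UnitDisc) :
    monomial 0 a z = a := by
  simp [monomial_apply]

theorem hasSum_apply_disc [CompleteSpace E] (f : Hardy 1 E) (w : UnitDisc) :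
    HasSum (fun m : ℕ => (w : ℂ) ^ m • f.coeff fun _ => m) (f (discPt w)) := by
  rw [← (Equiv.funUnique (Fin 1) ℕ).hasSum_iff]
  convert hasSum_apply f (discPt w) using 2 with k
  have hk : (fun _ => k 0) = k := funext fun i => by rw [Subsingleton.elim i 0]
  simp [hk]

theorem ext_disc [CompleteSpace E] {f g : Hardy 1 E}
    (h : ∀ w : UnitDisc, f (discPt w) = g (discPt w)) : f = g :=
  RKHS.ext (𝕜 := ℂ) fun z => by
    have hz : z = discPt (z 0) := funext fun i => by rw [Subsingleton.elim i 0]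
    rw [hz]
    exact h _

theorem mulZ_pow_apply [CompleteSpace E] (m : ℕ) (f : Hardy 1 E) (w : UnitDisc) :
    (mulZ E ^ m) f (discPt w) = (w : ℂ) ^ m • f (discPt w) := by
  induction m with
  | zero => simp
  | succ m ih =>
    rw [pow_succ', mul_apply_eq_comp]
    exact (mulCoord_apply _ _ _).trans (by rw [ih, smul_smul, ← pow_succ'])

theorem mulZ_pow_monomial_zero [CompleteSpace E] (k : Fin 1 → ℕ) (a : E) :
    (mulZ E ^ k 0) (monomial 0 a) = monomial k a := by
  refine ext_disc fun w => ?_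
  rw [mulZ_pow_apply, monomial_zero_apply, monomial_apply]
  simp

end Monomial

end Hardy

/-! ### Operators commuting with the shift are multiplication operators -/

section Symbol

variable {W F : Type*}
  [NormedAddCommGroup W] [InnerProductSpace ℂ W] [NormedAddCommGroup F] [InnerProductSpace ℂ F]

/-- The symbol of an operator `T : H²_W(𝔻) → H²_F(𝔻)`: the operator-valued function
`T̂(w) = ∑ₘ wᵐ Aₘ`, where `Aₘ η` is the `m`-th coefficient of `T` applied to the constant
function `η`. It is only of interest for `w` in the disc. -/
def symbol (T : Hardy 1 W →L[ℂ] Hardy 1 F) (w : ℂ) : W →L[ℂ] F :=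
  ∑' m : ℕ, w ^ m • (Hardy.coeffCLM (fun _ => m) ∘L T ∘L Hardy.monomial 0)

variable (T : Hardy 1 W →L[ℂ] Hardy 1 F)

theorem norm_symbol_term_le (w : ℂ) (m : ℕ) :
    ‖w ^ m • (Hardy.coeffCLM (fun _ => m) ∘L T ∘L Hardy.monomial 0)‖ ≤ ‖w‖ ^ m * ‖T‖ := by
  rw [norm_smul, norm_pow]
  gcongr
  refine ContinuousLinearMap.opNorm_le_bound _ (norm_nonneg _) fun a => ?_
  refine (Hardy.norm_coeff_le _ _).trans ?_
  rw [← Hardy.norm_monomial (0 : Fin 1 → ℕ) a]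
  exact T.le_opNorm _

variable [CompleteSpace F]

theorem differentiableOn_symbol : DifferentiableOn ℂ (symbol T) (Metric.ball 0 1) := by
  intro w hw
  obtain ⟨r, hwr, hr1⟩ := exists_between (mem_ball_zero_iff.1 hw)
  have hr0 : 0 ≤ r := (norm_nonneg w).trans hwr.le
  have hd : DifferentiableOn ℂ (symbol T) (Metric.ball 0 r) := by
    refine Complex.differentiableOn_tsum_of_summable_norm
      ((summable_geometric_of_lt_one hr0 hr1).mul_right ‖T‖)
      (fun m => by fun_prop) Metric.isOpen_ball fun m v hv => ?_
    refine (norm_symbol_term_le T v m).trans ?_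
    gcongr
    exact (mem_ball_zero_iff.1 hv).le
  exact (hd.differentiableAt (Metric.isOpen_ball.mem_nhds
    (mem_ball_zero_iff.2 hwr))).differentiableWithinAt

theorem symbol_apply (w : UnitDisc) (a : W) :
    symbol T w a = T (Hardy.monomial 0 a) (discPt w) := by
  have hs : Summable fun m : ℕ =>
      (w : ℂ) ^ m • (Hardy.coeffCLM (fun _ => m) ∘L T ∘L Hardy.monomial 0) :=
    .of_norm_bounded ((summable_geometric_of_lt_one (norm_nonneg _) w.norm_lt_one).mul_right ‖T‖)
      (norm_symbol_term_le T w)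
  exact (hs.hasSum.mapL (ContinuousLinearMap.apply ℂ F a)).unique (Hardy.hasSum_apply_disc _ w)

variable [CompleteSpace W]

theorem map_mulZ_pow (hT : ∀ f, T (mulZ W f) = mulZ F (T f)) (m : ℕ) (f : Hardy 1 W) :
    T ((mulZ W ^ m) f) = (mulZ F ^ m) (T f) := by
  induction m with
  | zero => simp
  | succ m ih => simp only [pow_succ', mul_apply_eq_comp, hT, ih]

/-- An operator commuting with the shift is multiplication by its symbol. -/
theorem isMul_symbol (hT : ∀ f, T (mulZ W f) = mulZ F (T f)) (f : Hardy 1 W) :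
    IsMul (symbol T) f (T f) := by
  intro w
  have h1 := (((Hardy.hasSum_monomial_coeff f).mapL T).mapL (Hardy.evalCLM (discPt w)))
  have h2 := (Hardy.hasSum_apply f (discPt w)).mapL (symbol T w)
  refine h1.unique (h2.congr_fun fun k => ?_)
  have h3 : T (Hardy.monomial k (f.coeff k)) (discPt w) =
      (w : ℂ) ^ k 0 • symbol T w (f.coeff k) := by
    rw [← Hardy.mulZ_pow_monomial_zero, map_mulZ_pow T hT, Hardy.mulZ_pow_apply, symbol_apply]
  refine Eq.trans h3 ?_
  simp

theorem Hardy.norm_kernel_self_le (w : UnitDisc) :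
    ‖RKHS.kernel (Hardy 1 F) (discPt w) (discPt w)‖ ≤ ‖(1 - (w : ℂ) * conj (w : ℂ))⁻¹‖ := by
  rw [Hardy.kernel_eq, norm_smul]
  refine (mul_le_of_le_one_right (norm_nonneg _) ContinuousLinearMap.norm_id_le).trans ?_
  simp

/-- The symbol of an operator commuting with the shift is bounded by the norm of the operator, as
one sees by applying the operator to the kernel functions. -/
theorem norm_symbol_le (hT : ∀ f, T (mulZ W f) = mulZ F (T f)) (w : UnitDisc) :
    ‖symbol T w‖ ≤ ‖T‖ := by
  refine ContinuousLinearMap.opNorm_le_bound _ (norm_nonneg _) fun a => ?_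
  set c : ℂ := (1 - (w : ℂ) * conj (w : ℂ))⁻¹ with hc
  have hc0 : 0 < ‖c‖ := by
    refine norm_pos_iff.2 (inv_ne_zero (sub_ne_zero.2 fun h => ?_))
    have h1 : ‖(w : ℂ) * conj (w : ℂ)‖ < 1 := by
      rw [norm_mul, RCLike.norm_conj]
      exact mul_lt_one_of_nonneg_of_lt_one_left (norm_nonneg _) w.norm_lt_one w.norm_lt_one.le
    rw [← h, norm_one] at h1
    exact h1.false
  set f := RKHS.kerFun (Hardy 1 W) (discPt w) a with hf
  have hfw : f (discPt w) = c • a := by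
    rw [hf, RKHS.kerFun_apply, Hardy.kernel_eq]
    simp [hc]
  have hfn : ‖f‖ ≤ √‖c‖ * ‖a‖ := by
    refine (ContinuousLinearMap.le_opNorm _ a).trans ?_
    rw [RKHS.norm_kerFun_eq_sqrt_norm_kernel]
    gcongr
    exact Hardy.norm_kernel_self_le w
  have hTf : ‖c‖ * ‖symbol T w a‖ ≤ ‖T f‖ * √‖c‖ := by
    rw [← norm_smul, ← map_smul, ← hfw, ← isMul_symbol T hT f w]
    refine (RKHS.norm_apply_le (𝕜 := ℂ) (T f) (discPt w)).trans ?_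
    gcongr
    exact Hardy.norm_kernel_self_le w
  refine le_of_mul_le_mul_left ?_ hc0
  calc ‖c‖ * ‖symbol T w a‖ ≤ ‖T f‖ * √‖c‖ := hTf
    _ ≤ ‖T‖ * (√‖c‖ * ‖a‖) * √‖c‖ := by
      gcongr
      exact (T.le_opNorm f).trans (by gcongr)
    _ = (√‖c‖ * √‖c‖) * (‖T‖ * ‖a‖) := by ring
    _ = ‖c‖ * (‖T‖ * ‖a‖) := by rw [Real.mul_self_sqrt (norm_nonneg c)]

theorem isBoundedAnalytic_symbol (hT : ∀ f, T (mulZ W f) = mulZ F (T f)) :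
    IsBoundedAnalytic (symbol T) :=
  ⟨differentiableOn_symbol T, ‖T‖, norm_symbol_le T hT⟩

end Symbol

/-! ### The Wold decomposition of an invariant subspace -/

namespace InvariantSubspace

section Wold

variable {n : ℕ} {E : Type*} [NormedAddCommGroup E] [InnerProductSpace ℂ E] [CompleteSpace E]
  (S : InvariantSubspace n E)

theorem norm_backShift_le : ‖S.backShift‖ ≤ 1 := by
  have h1 : ‖mulZ (Hardy n E)‖ ≤ 1 :=
    ContinuousLinearMap.opNorm_le_bound _ zero_le_one fun f => by
      rw [one_mul]; exact (Hardy.norm_mulCoord 0 f).le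
  refine ContinuousLinearMap.opNorm_le_bound _ zero_le_one fun f => ?_
  refine (S.space.norm_orthogonalProjectionOnto_apply_le _).trans ?_
  refine (ContinuousLinearMap.adjoint (mulZ (Hardy n E))).le_of_opNorm_le ?_ (f : _)
  rwa [LinearIsometryEquiv.norm_map]

/-- The projection of `S` onto the wandering subspace. -/
def wanderingProj : S.space →L[ℂ] S.wandering :=
  S.wandering.orthogonalProjectionOnto ∘L S.space.subtypeL

theorem inner_backShift (g f : S.space) :
    ⟪(g : Hardy 1 (Hardy n E)), S.backShift f⟫_ℂ =
      ⟪mulZ (Hardy n E) g, (f : Hardy 1 (Hardy n E))⟫_ℂ := by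
  rw [← ContinuousLinearMap.adjoint_inner_right]
  exact S.space.inner_orthogonalProjectionOnto_eq_of_mem_left g _

/-- On `S`, the projection onto `W = S ⊖ zS` is `I - T T^*` for the isometry `T = M_z|_S`. -/
theorem coe_wanderingProj (f : S.space) :
    (S.wanderingProj f : Hardy 1 (Hardy n E)) = f - mulZ (Hardy n E) (S.backShift f) := by
  refine (Submodule.eq_starProjection_of_mem_orthogonal (K := S.wandering) ⟨?_, ?_⟩ ?_)
  · exact S.space.sub_mem f.2 (S.mulZ_mem _ (S.backShift f).2)
  · rintro _ ⟨g, hg, rfl⟩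
    rw [inner_sub_right]
    refine sub_eq_zero.2 ((S.inner_backShift ⟨g, hg⟩ f).symm.trans ?_)
    exact ((Hardy.mulCoordIsometry 0).inner_map_map g (S.backShift f : Hardy 1 (Hardy n E))).symm
  · intro g hg
    change ⟪g, (f : Hardy 1 (Hardy n E)) - (f - mulZ (Hardy n E) (S.backShift f))⟫_ℂ = 0
    rw [sub_sub_cancel]
    exact inner_eq_zero_symm.1 (hg.2 _ ⟨_, (S.backShift f).2, rfl⟩)

theorem norm_wanderingProj_sq (f : S.space) :
    ‖S.wanderingProj f‖ ^ 2 = ‖f‖ ^ 2 - ‖S.backShift f‖ ^ 2 := by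
  have h0 : ⟪(S.wanderingProj f : Hardy 1 (Hardy n E)), mulZ (Hardy n E) (S.backShift f)⟫_ℂ = 0 :=
    inner_eq_zero_symm.1 ((S.wanderingProj f).2.2 _ ⟨_, (S.backShift f).2, rfl⟩)
  have h1 := norm_add_sq_eq_norm_sq_add_norm_sq_of_inner_eq_zero _ _ h0
  rw [coe_wanderingProj, sub_add_cancel, ← coe_wanderingProj] at h1
  have h2 : ‖mulZ (Hardy n E) (S.backShift f)‖ = ‖S.backShift f‖ := Hardy.norm_mulCoord 0 _
  rw [h2] at h1
  simp only [← pow_two, Submodule.coe_norm] at h1 ⊢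
  linarith

theorem sum_norm_wanderingProj_sq (f : S.space) (N : ℕ) :
    ∑ m ∈ Finset.range N, ‖S.wanderingProj ((S.backShift ^ m) f)‖ ^ 2 =
      ‖f‖ ^ 2 - ‖(S.backShift ^ N) f‖ ^ 2 := by
  induction N with
  | zero => simp
  | succ N ih =>
    rw [Finset.sum_range_succ, ih, norm_wanderingProj_sq, pow_succ' S.backShift, mul_apply_eq_comp]
    ring

theorem summable_norm_wanderingProj_sq (f : S.space) :
    Summable fun k : Fin 1 → ℕ => ‖S.wanderingProj ((S.backShift ^ k 0) f)‖ ^ 2 := by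
  have h : Summable fun m : ℕ => ‖S.wanderingProj ((S.backShift ^ m) f)‖ ^ 2 :=
    summable_of_sum_range_le (c := ‖f‖ ^ 2) (fun _ => by positivity) fun N => by
      rw [sum_norm_wanderingProj_sq]
      exact sub_le_self _ (by positivity)
  exact (Equiv.funUnique (Fin 1) ℕ).summable_iff.2 h

/-- The Wold decomposition of `f ∈ S`: the element of `H²_W(𝔻)` whose coefficients are the
components `P_W (P_S M_z^*)ᵐ f` of `f` in `W`. -/
def wold (f : S.space) : Hardy 1 S.wandering :=
  Hardy.ofCoeff _ (S.summable_norm_wanderingProj_sq f)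

theorem wold_apply (f : S.space) (w : UnitDisc) :
    S.wold f (discPt w) = S.wanderingProj (Ring.inverse (1 - (w : ℂ) • S.backShift) f) := by
  refine (Hardy.hasSum_apply_disc _ w).unique ?_
  have hw : ‖(w : ℂ) • S.backShift‖ < 1 :=
    (ContinuousLinearMap.opNorm_smul_le _ _).trans_lt
      ((mul_le_of_le_one_right (norm_nonneg _) S.norm_backShift_le).trans_lt w.norm_lt_one)
  have h := (hasSum_geom_series_inverse _ hw).mapL (ContinuousLinearMap.apply ℂ S.space f)
  refine (h.mapL S.wanderingProj).congr_fun fun m => ?_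
  simp [smul_pow, wold]

/-- For each `η ∈ W` the function `w ↦ Φ_i(w) η` belongs to `H²_W(𝔻)`. -/
theorem wold_kappaRestrict_apply (i : Fin n) (η : S.wandering) (w : UnitDisc) :
    S.wold (S.kappaRestrict i η) (discPt w) = S.phi i w η :=
  S.wold_apply _ w

end Wold

end InvariantSubspace

/-! ### Factorization through isometries -/

/-- An operator whose range lies in the range of an isometry factors through the isometry. -/
theorem LinearIsometry.exists_comp_eq {X Y Z : Type*}
    [NormedAddCommGroup X] [NormedSpace ℂ X] [NormedAddCommGroup Y] [NormedSpace ℂ Y]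
    [NormedAddCommGroup Z] [NormedSpace ℂ Z] (V : X →ₗᵢ[ℂ] Y) (A : Z →L[ℂ] Y)
    (h : ∀ z, ∃ x, V x = A z) : ∃ L : Z →L[ℂ] X, ∀ z, V (L z) = A z := by
  refine ⟨V.equivRange.symm.toLinearIsometry.toContinuousLinearMap ∘L
    A.codRestrict V.toLinearMap.range h, fun z => ?_⟩
  exact congrArg Subtype.val (V.equivRange.apply_symm_apply ⟨A z, h z⟩)

section Multiplier

variable {W F : Type*}
  [NormedAddCommGroup W] [InnerProductSpace ℂ W] [CompleteSpace W]
  [NormedAddCommGroup F] [InnerProductSpace ℂ F] [CompleteSpace F]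
  {Θ : ℂ → W →L[ℂ] F} {M : Hardy 1 W →ₗᵢ[ℂ] Hardy 1 F}

theorem eq_of_isMul (hM : ∀ f, IsMul Θ f (M f)) {f : Hardy 1 W} {g : Hardy 1 F}
    (h : IsMul Θ f g) : M f = g :=
  Hardy.ext_disc fun w => (hM f w).trans (h w).symm

theorem map_mulZ_of_isMul (hM : ∀ f, IsMul Θ f (M f)) (f : Hardy 1 W) :
    M (mulZ W f) = mulZ F (M f) :=
  eq_of_isMul hM fun w => by
    have h1 : mulZ F (M f) (discPt w) = (w : ℂ) • M f (discPt w) := Hardy.mulCoord_apply _ _ _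
    have h2 : mulZ W f (discPt w) = (w : ℂ) • f (discPt w) := Hardy.mulCoord_apply _ _ _
    rw [h1, h2, map_smul, hM f w]

theorem mem_mulRange_iff (hM : ∀ f, IsMul Θ f (M f)) {g : Hardy 1 F} :
    g ∈ mulRange Θ ↔ ∃ f, M f = g :=
  ⟨fun ⟨f, hf⟩ => ⟨f, eq_of_isMul hM hf⟩, fun ⟨f, hf⟩ => ⟨f, hf ▸ hM f⟩⟩

end Multiplier

/-! ### Coordinate multiplications on an invariant subspace -/

section Model

variable {n : ℕ} {E : Type*} [NormedAddCommGroup E] [InnerProductSpace ℂ E] [CompleteSpace E]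

theorem mulKappa_mulZ (i : Fin n) (f : Hardy 1 (Hardy n E)) :
    mulKappa n E i (mulZ _ f) = mulZ _ (mulKappa n E i f) :=
  Hardy.ext_disc fun w => by
    have h (g : Hardy 1 (Hardy n E)) : mulZ _ g (discPt w) = (w : ℂ) • g (discPt w) :=
      Hardy.mulCoord_apply _ _ _
    rw [isMul_mulKappa, h, h, map_smul, isMul_mulKappa]

/-- If `S = Θ H²_W(𝔻)` with `Θ` inner and `κ_i Θ = Θ Φ_i`, then under `M_Θ` the operator
`M_{κ_i}|_S` corresponds to an operator on `H²_W(𝔻)` that is multiplication by `Φ_i`. -/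
theorem InvariantSubspace.exists_phi_multiplier (S : InvariantSubspace n E)
    {Θ : ℂ → S.wandering →L[ℂ] Hardy n E}
    {M : Hardy 1 S.wandering →ₗᵢ[ℂ] Hardy 1 (Hardy n E)} (hM : ∀ f, IsMul Θ f (M f))
    (hS : (S.space : Set (Hardy 1 (Hardy n E))) = mulRange Θ) (i : Fin n)
    (hκ : ∀ w : UnitDisc, kappa n E i w ∘L Θ w = Θ w ∘L S.phi i w) :
    ∃ N : Hardy 1 S.wandering →L[ℂ] Hardy 1 S.wandering,
      (∀ f, M (N f) = mulKappa n E i (M f)) ∧ ∀ f, IsMul (S.phi i) f (N f) := by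
  have hmem (g) : g ∈ S.space ↔ ∃ f, M f = g := by
    rw [← SetLike.mem_coe, hS, mem_mulRange_iff hM]
  obtain ⟨N, hN⟩ := M.exists_comp_eq (mulKappa n E i ∘L M.toContinuousLinearMap)
    fun f => (hmem _).1 (S.mulKappa_mem i _ ((hmem _).2 ⟨f, rfl⟩))
  replace hN : ∀ f, M (N f) = mulKappa n E i (M f) := hN
  have hNz (f) : N (mulZ _ f) = mulZ _ (N f) := M.injective <| by
    rw [hN, map_mulZ_of_isMul hM, map_mulZ_of_isMul hM, hN, mulKappa_mulZ]
  refine ⟨N, hN, fun f w => ?_⟩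
  rw [isMul_symbol N hNz f w]
  congr 1
  ext1 η
  -- `Θ(w)` need not be injective for a single `w`, but `M_Θ` is injective on `H²_W(𝔻)`, and both
  -- `N η` and `Φ_i η` are elements of that space.
  have h : N (Hardy.monomial 0 η) = S.wold (S.kappaRestrict i η) := M.injective <| by
    refine Hardy.ext_disc fun v => ?_
    rw [hN, isMul_mulKappa, hM _ v, hM _ v, Hardy.monomial_zero_apply, S.wold_kappaRestrict_apply]
    exact DFunLike.congr_fun (hκ v) η
  rw [symbol_apply, h, S.wold_kappaRestrict_apply]

end Model

end

/-! ### Inclusion of invariant subspaces -/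

theorem theorem5p1 {n : ℕ} {E : Type*} [NormedAddCommGroup E] [InnerProductSpace ℂ E]
    [CompleteSpace E] (S₁ S₂ : InvariantSubspace n E)
    (Θ₁ : ℂ → S₁.wandering →L[ℂ] Hardy n E) (Θ₂ : ℂ → S₂.wandering →L[ℂ] Hardy n E)
    (hΘ₁ : IsInner Θ₁) (hΘ₂ : IsInner Θ₂)
    (hS₁ : (S₁.space : Set (Hardy 1 (Hardy n E))) = mulRange Θ₁)
    (hS₂ : (S₂.space : Set (Hardy 1 (Hardy n E))) = mulRange Θ₂)
    (hκ₁ : ∀ i, ∀ w : UnitDisc, kappa n E i w ∘L Θ₁ w = Θ₁ w ∘L S₁.phi i w)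
    (hκ₂ : ∀ i, ∀ w : UnitDisc, kappa n E i w ∘L Θ₂ w = Θ₂ w ∘L S₂.phi i w) :
    S₁.space ≤ S₂.space ↔
      ∃ Ψ : ℂ → S₁.wandering →L[ℂ] S₂.wandering, IsInner Ψ ∧
        (∀ w : UnitDisc, Θ₁ w = Θ₂ w ∘L Ψ w) ∧
        ∀ i, ∀ w : UnitDisc, Ψ w ∘L S₁.phi i w = S₂.phi i w ∘L Ψ w := by
  obtain ⟨-, M₁, hM₁⟩ := hΘ₁
  obtain ⟨-, M₂, hM₂⟩ := hΘ₂
  have hmem₁ (g) : g ∈ S₁.space ↔ ∃ f, M₁ f = g := by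
    rw [← SetLike.mem_coe, hS₁, mem_mulRange_iff hM₁]
  have hmem₂ (g) : g ∈ S₂.space ↔ ∃ f, M₂ f = g := by
    rw [← SetLike.mem_coe, hS₂, mem_mulRange_iff hM₂]
  constructor
  · intro hle
    obtain ⟨L, hL⟩ := M₂.exists_comp_eq M₁.toContinuousLinearMap
      fun f => (hmem₂ _).1 (hle ((hmem₁ _).2 ⟨f, rfl⟩))
    replace hL : ∀ f, M₂ (L f) = M₁ f := hL
    have hLz (f) : L (mulZ _ f) = mulZ _ (L f) := M₂.injective <| by
      rw [hL, map_mulZ_of_isMul hM₁, map_mulZ_of_isMul hM₂, hL]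
    have hLn (f) : ‖L f‖ = ‖f‖ := by rw [← M₂.norm_map, hL, M₁.norm_map]
    have hmul := isMul_symbol L hLz
    refine ⟨symbol L, ⟨isBoundedAnalytic_symbol L hLz, ⟨L.toLinearMap, hLn⟩, hmul⟩,
      fun w => ?_, fun i w => ?_⟩
    · ext1 η
      have h := hM₁ (Hardy.monomial 0 η) w
      rw [← hL, hM₂ _ w, hmul _ w, Hardy.monomial_zero_apply] at h
      exact h.symm
    · obtain ⟨N₁, hN₁, hφ₁⟩ := S₁.exists_phi_multiplier hM₁ hS₁ i (hκ₁ i)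
      obtain ⟨N₂, hN₂, hφ₂⟩ := S₂.exists_phi_multiplier hM₂ hS₂ i (hκ₂ i)
      have hLN (f) : L (N₁ f) = N₂ (L f) := M₂.injective <| by
        rw [hL, hN₁, hN₂, hL]
      ext1 η
      have h := congrArg (fun g : Hardy 1 S₂.wandering => g (discPt w))
        (hLN (Hardy.monomial 0 η))
      simp only [hmul _ w, hφ₁ _ w, hφ₂ _ w, Hardy.monomial_zero_apply] at h
      exact h
  · rintro ⟨Ψ, ⟨-, M, hM⟩, hΘ, -⟩ g hg
    obtain ⟨f, rfl⟩ := (hmem₁ g).1 hg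
    refine (hmem₂ _).2 ⟨M f, eq_of_isMul hM₂ fun w => ?_⟩
    rw [hM₁ f w, hΘ w, hM f w]
    rfl
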